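/- Let $\mathbb{O}$ be the octonions with basis $e_0=1,e_1,\dots,e_7$, where $e_4=e_1e_2$, $e_5=e_1e_3$, $e_6=e_2e_3$, $e_7=(e_1e_2)e_3$; write $z=\sum_{i=0}^7 x_ie_i$, $\bar z=x_0-\sum_{i\ge1}x_ie_i$, $N(z)=z\bar z=|z|^2=\sum_i x_i^2$ and $z^{-1}=\bar z/N(z)$. Let $q_0(z)=\bar z/|z|^8$, $q_{\tau(i)}=\partial q_0/\partial x_i$ and $V_{\tau(j)}(z)=x_j-x_0e_j$. Let $\omega_0=1,\omega_1,\dots,\omega_7\in\mathbb{O}$ be $\mathbb{R}$-linearly independent, $\Omega_8=\mathbb{Z}+\mathbb{Z}\omega_1+\dots+\mathbb{Z}\omega_7$, and define, for $z\notin\Omega_8$ and $i=1,\dots,7$, $$\wp_{\tau(i)}(z)=q_{\tau(i)}(z)+\sum_{\omega\in\Omega_8\setminus\{0\}}\bigl(q_{\tau(i)}(z+\omega)-q_{\tau(i)}(\omega)\bigr),$$ $$\zeta(z)=q_0(z)+\sum_{\omega\in\Omega_8\setminus\{0\}}\Bigl(q_0(z+\omega)-q_0(\omega)-\sum_{j=1}^7V_{\tau(j)}(z)\,q_{\tau(j)}(\omega)\Bigr).$$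 Let $\lambda,\mu\in\mathbb{O}\setminus\{0\}$ satisfy $\lambda\Omega_8\subseteq\Omega_8$ and $\Omega_8\mu\subseteq\Omega_8$. Let $\mathcal F=\{\sum_{j=0}^7\alpha_j\omega_j : 0\le\alpha_j<1\}$ and $\mathcal V=\{v\in\mathcal F : v=(\lambda^{-1}\omega)\mu^{-1}\text{ for some }\omega\in\Omega_8\}$. Let $W=(\omega_{hl})_{h,l=0}^7$ be the matrix of coordinates given by $\omega_h=\sum_{l=0}^7\omega_{hl}e_l$, and let $\Theta_{hl}$ be the (signed) cofactor of $W$ at the entry $\omega_{hl}$. Theorem. The two series converge absolutely for every $z\notin\Omega_8$, and $\mathcal V$ is finite. There are octonions $\eta_0,\dots,\eta_7$ (the Legendre constants) with $\zeta(z+\omega_h)-\zeta(z)=\eta_h$ for all $z\notin\Omega_8$ and all $h$, and integers $n_{hj}$ with $\lambda(\omega_h\mu)=\sum_{j=0}^7n_{hj}\omega_j$ for all $h$; and for $i=1,\dots,7$ $$\sum_{v\in\mathcal V\setminus\{0\}}\wp_{\tau(i)}(v)=-\frac{(N(\lambda)N(\mu))^3}{\det(W)}\Bigl[\sum_{h=0}^7\Theta_{hi}\,\mu\Bigl(\Bigl(\sum_{j=0}^7n_{hj}\eta_j\Bigr)\lambda\Bigr)-N(\lambda)N(\mu)\sum_{h=0}^7\Theta_{hi}\eta_h\Bigr].$$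 -/

import Mathlib

noncomputable section

/-- The real vector space underlying the octonions: `x = x₀ + x₁ e₁ + ⋯ + x₇ e₇`, with the
Euclidean norm of `ℝ⁸`. -/
abbrev Octonion : Type := EuclideanSpace ℝ (Fin 8)

namespace Octonion

/-- The canonical basis `e₀ = 1, e₁, …, e₇`. -/
def e (i : Fin 8) : Octonion := EuclideanSpace.single i 1

/-- The octonionic product for the convention `e₄ = e₁ e₂`, `e₅ = e₁ e₃`, `e₆ = e₂ e₃`,
`e₇ = (e₁ e₂) e₃`. -/
instance : Mul Octonion where
  mul x y := !₂[
    x 0 * y 0 - x 1 * y 1 - x 2 * y 2 - x 3 * y 3 - x 4 * y 4 - x 5 * y 5 - x 6 * y 6 - x 7 * y 7,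
    x 0 * y 1 + x 1 * y 0 + x 2 * y 4 + x 3 * y 5 - x 4 * y 2 - x 5 * y 3 - x 6 * y 7 + x 7 * y 6,
    x 0 * y 2 - x 1 * y 4 + x 2 * y 0 + x 3 * y 6 + x 4 * y 1 + x 5 * y 7 - x 6 * y 3 - x 7 * y 5,
    x 0 * y 3 - x 1 * y 5 - x 2 * y 6 + x 3 * y 0 - x 4 * y 7 + x 5 * y 1 + x 6 * y 2 + x 7 * y 4,
    x 0 * y 4 + x 1 * y 2 - x 2 * y 1 + x 3 * y 7 + x 4 * y 0 - x 5 * y 6 + x 6 * y 5 - x 7 * y 3,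
    x 0 * y 5 + x 1 * y 3 - x 2 * y 7 - x 3 * y 1 + x 4 * y 6 + x 5 * y 0 - x 6 * y 4 + x 7 * y 2,
    x 0 * y 6 + x 1 * y 7 + x 2 * y 3 - x 3 * y 2 - x 4 * y 5 + x 5 * y 4 + x 6 * y 0 - x 7 * y 1,
    x 0 * y 7 - x 1 * y 6 + x 2 * y 5 - x 3 * y 4 + x 4 * y 3 - x 5 * y 2 + x 6 * y 1 + x 7 * y 0]

/-- Octonionic conjugation. -/
def conj (x : Octonion) : Octonion :=
  !₂[x 0, -x 1, -x 2, -x 3, -x 4, -x 5, -x 6, -x 7]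

/-- The norm `N(x) = x x̄ = |x|²`. -/
def N (x : Octonion) : ℝ := ∑ i, x i ^ 2

/-- The multiplicative inverse of a nonzero octonion. -/
def inverse (x : Octonion) : Octonion := (N x)⁻¹ • conj x

/-- The Cauchy kernel `q₀(z) = z̄ / |z|⁸`. -/
def q0 (z : Octonion) : Octonion := (‖z‖ ^ 8)⁻¹ • conj z

/-- The partial derivative `q_{τ(i)} = ∂ q₀ / ∂ x_i`. -/
def q (i : Fin 8) (z : Octonion) : Octonion := lineDeriv ℝ q0 z (e i)

/-- The Fueter polynomial `V_{τ(j)}(z) = x_j - x₀ e_j`. -/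
def V (j : Fin 8) (z : Octonion) : Octonion := z j • e 0 - z 0 • e j

/-- The lattice `Ω = ℤ ω₀ + ⋯ + ℤ ω₇`. -/
def lattice (ω : Fin 8 → Octonion) : Set Octonion :=
  {x | ∃ n : Fin 8 → ℤ, x = ∑ j, n j • ω j}

/-- The general term, for `w ∈ Ω \ {0}`, of the series for `℘_{τ(i)}`. -/
def wpTerm (i : Fin 8) (z w : Octonion) : Octonion := q i (z + w) - q i w

/-- The elliptic function `℘_{τ(i)}` of the lattice spanned by `ω`. -/
def wp (ω : Fin 8 → Octonion) (i : Fin 8) (z : Octonion) : Octonion :=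
  q i z + ∑' w : ↥(lattice ω \ {0}), wpTerm i z w

/-- The general term, for `w ∈ Ω \ {0}`, of the series for `ζ`. -/
def zetaTerm (z w : Octonion) : Octonion :=
  q0 (z + w) - q0 w - ∑ j ∈ Finset.univ.erase (0 : Fin 8), V j z * q j w

/-- The Weierstrass `ζ`-function of the lattice spanned by `ω`. -/
def zeta (ω : Fin 8 → Octonion) (z : Octonion) : Octonion :=
  q0 z + ∑' w : ↥(lattice ω \ {0}), zetaTerm z w

/-- `lam` is a left multiplicator of the lattice: `lam Ω ⊆ Ω`. -/
def IsLeftMultiplicator (ω : Fin 8 → Octonion) (lam : Octonion) : Prop :=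
  ∀ w ∈ lattice ω, lam * w ∈ lattice ω

/-- `mu` is a right multiplicator of the lattice: `Ω mu ⊆ Ω`. -/
def IsRightMultiplicator (ω : Fin 8 → Octonion) (mu : Octonion) : Prop :=
  ∀ w ∈ lattice ω, w * mu ∈ lattice ω

/-- The half-open fundamental cell of the lattice. -/
def fundamentalCell (ω : Fin 8 → Octonion) : Set Octonion :=
  {x | ∃ α : Fin 8 → ℝ, (∀ j, 0 ≤ α j ∧ α j < 1) ∧ x = ∑ j, α j • ω j}

/-- The division points `(lam⁻¹ w) mu⁻¹`, `w ∈ Ω`, in the fundamental cell. -/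
def divisionPoints (ω : Fin 8 → Octonion) (lam mu : Octonion) : Set Octonion :=
  {v | v ∈ fundamentalCell ω ∧ ∃ w ∈ lattice ω, v = (inverse lam * w) * inverse mu}

/-- The period matrix `W = (ω_{hl})`, whose row `h` lists the coordinates of `ω_h`. -/
def periodMatrix (ω : Fin 8 → Octonion) : Matrix (Fin 8) (Fin 8) ℝ :=
  Matrix.of fun h l => ω h l

/-- The (signed) cofactor `Θ_{hl}` of `W` at the entry `ω_{hl}`; the adjugate is the transpose of
the cofactor matrix. -/
def Θ (ω : Fin 8 → Octonion) (h l : Fin 8) : ℝ := (periodMatrix ω).adjugate l h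

end Octonion

end

namespace Octonion

/-! ### The algebra of octonions -/

/-! Put `c = N lam * N mu` and `S z = lam * (z * mu)`. Multiplicativity of `N` makes `S` a
similarity of ratio `√c`, so `|det S| = c ^ 4`. Alternativity shows that `S' u = mu * (u * lam)`
undoes `S` under conjugation, whence `c ^ 3 • S' (q0 (S z)) = q0 z`, and likewise for the derivative
`K` of `q0` (`q0_sandwich`, `kernelDeriv_sandwich`).

Since `q0` is left monogenic, the Fueter correction in `ζ` is just `K w z` (`sum_V_mul_q`). Thus `ζ
z` is the lattice sum of the first-order Taylor remainders `q0 (z + w) - q0 w - K w z`, and the `℘`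
functions are the components of the sum of `K (z + w) - K w`. As `q0 0 = 0` and `K 0 = 0` here, both
sums run over the whole lattice `Λ` and make sense even at lattice points; there `ζ 0 = 0`, so the
Legendre constants are the values `ζ (ω h)`.

Applying `c ^ 3 • S'` to the series of `ζ (S z)` turns it into the same series over `S⁻¹ Λ`.
Splitting this lattice into cosets of `Λ`, represented by the division points `v`, gives `c ^ 3 • S'
(ζ (S z)) = ∑ v, (ζ (z + v) - ζ v - ℘ v z)` (`smul_sandwich_zetaSum`). At `z = ω h`
quasi-periodicity evaluates both sides, and there are `c ^ 4` points `v` (`card_divisionSet`). This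
determines the linear map `∑ v, ℘ v` on the `ω h`; Cramer's rule (`sum_Θ_smul`) gives its values on
the `e i`. -/

theorem mul_apply (x y : Octonion) : x * y = !₂[
    x 0 * y 0 - x 1 * y 1 - x 2 * y 2 - x 3 * y 3 - x 4 * y 4 - x 5 * y 5 - x 6 * y 6 - x 7 * y 7,
    x 0 * y 1 + x 1 * y 0 + x 2 * y 4 + x 3 * y 5 - x 4 * y 2 - x 5 * y 3 - x 6 * y 7 + x 7 * y 6,
    x 0 * y 2 - x 1 * y 4 + x 2 * y 0 + x 3 * y 6 + x 4 * y 1 + x 5 * y 7 - x 6 * y 3 - x 7 * y 5,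
    x 0 * y 3 - x 1 * y 5 - x 2 * y 6 + x 3 * y 0 - x 4 * y 7 + x 5 * y 1 + x 6 * y 2 + x 7 * y 4,
    x 0 * y 4 + x 1 * y 2 - x 2 * y 1 + x 3 * y 7 + x 4 * y 0 - x 5 * y 6 + x 6 * y 5 - x 7 * y 3,
    x 0 * y 5 + x 1 * y 3 - x 2 * y 7 - x 3 * y 1 + x 4 * y 6 + x 5 * y 0 - x 6 * y 4 + x 7 * y 2,
    x 0 * y 6 + x 1 * y 7 + x 2 * y 3 - x 3 * y 2 - x 4 * y 5 + x 5 * y 4 + x 6 * y 0 - x 7 * y 1,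
    x 0 * y 7 - x 1 * y 6 + x 2 * y 5 - x 3 * y 4 + x 4 * y 3 - x 5 * y 2 + x 6 * y 1 + x 7 * y 0] :=
  rfl

theorem N_eq (x : Octonion) : N x = x 0 ^ 2 + x 1 ^ 2 + x 2 ^ 2 + x 3 ^ 2 + x 4 ^ 2 + x 5 ^ 2 +
    x 6 ^ 2 + x 7 ^ 2 := by
  simp [N, Fin.sum_univ_eight]

theorem N_eq_norm_sq (x : Octonion) : N x = ‖x‖ ^ 2 := by
  simp [N, EuclideanSpace.norm_sq_eq]

theorem N_pos {x : Octonion} (hx : x ≠ 0) : 0 < N x := by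
  rw [N_eq_norm_sq]; positivity

/-- Octonionic multiplication as a bilinear map. -/
def mulBilin : Octonion →ₗ[ℝ] Octonion →ₗ[ℝ] Octonion :=
  LinearMap.mk₂ ℝ (· * ·)
    (fun x y z => by ext i; fin_cases i <;> simp [mul_apply] <;> ring)
    (fun r x y => by ext i; fin_cases i <;> simp [mul_apply] <;> ring)
    (fun x y z => by ext i; fin_cases i <;> simp [mul_apply] <;> ring)
    (fun r x y => by ext i; fin_cases i <;> simp [mul_apply] <;> ring)

@[simp]
theorem mulBilin_apply (x y : Octonion) : mulBilin x y = x * y := rfl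

/-- Octonionic conjugation as a continuous linear map. -/
noncomputable def conjL : Octonion →L[ℝ] Octonion :=
  LinearMap.toContinuousLinearMap
    { toFun := conj
      map_add' := fun x y => by ext i; fin_cases i <;> simp [conj] <;> ring
      map_smul' := fun r x => by ext i; fin_cases i <;> simp [conj] }

@[simp]
theorem conjL_apply (x : Octonion) : conjL x = conj x := rfl

theorem N_conj (x : Octonion) : N (conj x) = N x := by
  simp [N_eq, conj]

theorem norm_conj (x : Octonion) : ‖conj x‖ = ‖x‖ := by
  rw [← sq_eq_sq₀ (norm_nonneg _) (norm_nonneg _), ← N_eq_norm_sq, ← N_eq_norm_sq, N_conj]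

theorem N_mul (x y : Octonion) : N (x * y) = N x * N y := by
  simp [N_eq, mul_apply]; ring

theorem conj_mul (x y : Octonion) : conj (x * y) = conj y * conj x := by
  ext i; fin_cases i <;> simp [mul_apply, conj] <;> ring

theorem mul_conj_mul_cancel (x y : Octonion) : (x * conj y) * y = N y • x := by
  ext i; fin_cases i <;> simp [mul_apply, conj, N_eq] <;> ring

theorem mul_conj_mul (x y : Octonion) : x * (conj x * y) = N x • y := by
  ext i; fin_cases i <;> simp [mul_apply, conj, N_eq] <;> ring

theorem smul_mul' (r : ℝ) (x y : Octonion) : (r • x) * y = r • (x * y) := by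
  exact DFunLike.congr_fun (mulBilin.map_smul r x) y

theorem mul_smul' (r : ℝ) (x y : Octonion) : x * (r • y) = r • (x * y) :=
  (mulBilin x).map_smul r y

theorem sum_mul' {ι : Type*} (s : Finset ι) (x : Octonion) (f : ι → Octonion) :
    (∑ i ∈ s, f i) * x = ∑ i ∈ s, f i * x :=
  map_sum (mulBilin.flip x) f s

theorem add_mul' (x y z : Octonion) : (x + y) * z = x * z + y * z :=
  map_add (mulBilin.flip z) x y

theorem e_zero_mul (x : Octonion) : e 0 * x = x := by
  ext i; fin_cases i <;> simp [mul_apply, e]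

/-- The map `z ↦ x (z y)`. -/
noncomputable def sandwich (x y : Octonion) : Octonion →L[ℝ] Octonion :=
  LinearMap.toContinuousLinearMap (mulBilin x ∘ₗ mulBilin.flip y)

@[simp]
theorem sandwich_apply (x y z : Octonion) : sandwich x y z = x * (z * y) := rfl

theorem norm_sq_sandwich (x y z : Octonion) : ‖sandwich x y z‖ ^ 2 = N x * N y * ‖z‖ ^ 2 := by
  simp only [← N_eq_norm_sq, sandwich_apply, N_mul]; ring

theorem inner_sandwich (x y z w : Octonion) :
    inner ℝ (sandwich x y z) (sandwich x y w) = N x * N y * inner ℝ z w := by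
  have h := norm_sq_sandwich x y (z + w)
  rw [map_add, norm_add_sq_real, norm_add_sq_real, norm_sq_sandwich, norm_sq_sandwich] at h
  linarith

/-- Conjugation reverses products, so the outer factors meet their conjugates and cancel by
alternativity; no associativity is needed. -/
theorem sandwich_conj_sandwich (x y z : Octonion) :
    sandwich y x (conj (sandwich x y z)) = (N x * N y) • conj z := by
  simp only [sandwich_apply, conj_mul, mul_conj_mul_cancel]
  rw [mul_smul', mul_conj_mul, smul_smul]

theorem sandwich_inverse {x y : Octonion} (hx : x ≠ 0) (hy : y ≠ 0) (z : Octonion) :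
    sandwich x y ((inverse x * z) * inverse y) = z := by
  have h : ((inverse x * z) * inverse y) = (N x)⁻¹ • (N y)⁻¹ • ((conj x * z) * conj y) := by
    simp only [inverse, smul_mul', mul_smul']
    rw [smul_comm]
  rw [h, map_smul, map_smul, sandwich_apply, mul_conj_mul_cancel, mul_smul', mul_conj_mul,
    smul_smul, smul_smul, smul_smul]
  have := (N_pos hx).ne'
  have := (N_pos hy).ne'
  rw [show (N x)⁻¹ * (N y)⁻¹ * N y * N x = 1 by field_simp, one_smul]

theorem sandwich_injective {x y : Octonion} (hx : x ≠ 0) (hy : y ≠ 0) :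
    Function.Injective (sandwich x y) := by
  rw [injective_iff_map_eq_zero]
  intro z hz
  have h := norm_sq_sandwich x y z
  rw [hz] at h
  have := N_pos hx
  have := N_pos hy
  have h' : N x * N y ≠ 0 := by positivity
  simpa [h'] using h.symm

theorem sandwich_eq_iff {x y : Octonion} (hx : x ≠ 0) (hy : y ≠ 0) (z w : Octonion) :
    z = (inverse x * w) * inverse y ↔ sandwich x y z = w := by
  rw [← (sandwich_injective hx hy).eq_iff, sandwich_inverse hx hy]

/-- A similarity satisfies `S* S = c • id`; in dimension 8 this gives `(det S) ^ 2 = c ^ 8`. -/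
theorem abs_det_sandwich (x y : Octonion) :
    |LinearMap.det (sandwich x y : Octonion →ₗ[ℝ] Octonion)| = (N x * N y) ^ 4 := by
  have hN : 0 ≤ N x * N y := by simp only [N_eq_norm_sq]; positivity
  have h : (sandwich x y : Octonion →ₗ[ℝ] Octonion).adjoint ∘ₗ
      (sandwich x y : Octonion →ₗ[ℝ] Octonion) = (N x * N y) • LinearMap.id := by
    ext1 z
    refine ext_inner_right ℝ fun w => ?_
    rw [LinearMap.comp_apply, LinearMap.adjoint_inner_left]
    simp only [ContinuousLinearMap.coe_coe, inner_sandwich, LinearMap.smul_apply,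
      LinearMap.id_apply, real_inner_smul_left]
  have h2 := congrArg LinearMap.det h
  rw [LinearMap.det_comp, LinearMap.det_smul] at h2
  have h3 : ∀ f : Octonion →ₗ[ℝ] Octonion, LinearMap.det f.adjoint = LinearMap.det f := fun f => by
    let b := EuclideanSpace.basisFun (Fin 8) ℝ
    rw [← LinearMap.det_toMatrix b.toBasis, LinearMap.toMatrix_adjoint b b,
      Matrix.det_conjTranspose, LinearMap.det_toMatrix, star_trivial]
  rw [h3, finrank_euclideanSpace_fin, LinearMap.det_id] at h2
  rw [← sq_eq_sq₀ (abs_nonneg _) (by positivity), sq_abs, sq, h2]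
  ring

end Octonion

/-! ### Estimates for homogeneous functions -/

theorem exists_norm_le_of_homogeneous {E F : Type*} [NormedAddCommGroup E] [NormedSpace ℝ E]
    [FiniteDimensional ℝ E] [NormedAddCommGroup F] [NormedSpace ℝ F] {g : E → F} {k : ℕ}
    (hg : ContinuousOn g {0}ᶜ) (hom : ∀ t : ℝ, 0 < t → ∀ x, g (t • x) = (t ^ k)⁻¹ • g x) :
    ∃ C, 0 ≤ C ∧ ∀ x, x ≠ 0 → ‖g x‖ ≤ C * (‖x‖ ^ k)⁻¹ := by
  have hc : IsCompact (Metric.sphere (0 : E) 1) := by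
    have := FiniteDimensional.proper ℝ E
    exact isCompact_sphere _ _
  obtain ⟨C, hC⟩ := hc.exists_bound_of_continuousOn
    (hg.mono fun x hx => ne_zero_of_mem_unit_sphere ⟨x, hx⟩)
  refine ⟨max C 0, le_max_right _ _, fun x hx => ?_⟩
  have hpos : 0 < ‖x‖ := norm_pos_iff.2 hx
  have h1 : x = ‖x‖ • (‖x‖⁻¹ • x) := by rw [smul_smul, mul_inv_cancel₀ hpos.ne', one_smul]
  have h2 : ‖x‖⁻¹ • x ∈ Metric.sphere (0 : E) 1 := by
    simp [norm_smul, hpos.ne']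
  conv_lhs => rw [h1]
  rw [hom _ hpos, norm_smul, mul_comm, norm_inv, norm_pow, norm_norm]
  gcongr
  exact (hC _ h2).trans (le_max_left _ _)

/-- The derivative of a homogeneous function of degree `-k` is homogeneous of degree
`-(k + 1)`. -/
theorem fderiv_homogeneous {E F : Type*} [NormedAddCommGroup E] [NormedSpace ℝ E]
    [NormedAddCommGroup F] [NormedSpace ℝ F] {g : E → F} {k : ℕ}
    (hom : ∀ t : ℝ, 0 < t → ∀ x, g (t • x) = (t ^ k)⁻¹ • g x) (t : ℝ) (ht : 0 < t) (x : E) :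
    fderiv ℝ g (t • x) = (t ^ (k + 1))⁻¹ • fderiv ℝ g x := by
  have h1 : (fun x => g (t • x)) = (t ^ k)⁻¹ • g := funext fun x => hom t ht x
  have h2 := fderiv_comp_smul (𝕜 := ℝ) (f := g) (x := x) t
  rw [h1, fderiv_const_smul_field] at h2
  rw [Pi.smul_apply] at h2
  rw [pow_succ', mul_inv, mul_smul, h2, smul_smul, inv_mul_cancel₀ ht.ne', one_smul]

theorem half_norm_lt_of_mem_ball {E : Type*} [NormedAddCommGroup E] {w x : E}
    (hx : x ∈ Metric.ball w (‖w‖ / 2)) : ‖w‖ / 2 < ‖x‖ := by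
  rw [mem_ball_iff_norm'] at hx
  linarith [norm_sub_norm_le w x]

theorem exists_norm_add_sub_le_of_homogeneous {E F : Type*} [NormedAddCommGroup E]
    [NormedSpace ℝ E] [FiniteDimensional ℝ E] [NormedAddCommGroup F] [NormedSpace ℝ F]
    {g : E → F} {k : ℕ} (hg : ContDiffOn ℝ 1 g {0}ᶜ)
    (hom : ∀ t : ℝ, 0 < t → ∀ x, g (t • x) = (t ^ k)⁻¹ • g x) :
    ∃ C, 0 ≤ C ∧ ∀ z w, 2 * ‖z‖ < ‖w‖ → ‖g (w + z) - g w‖ ≤ C * ‖z‖ * (‖w‖ ^ (k + 1))⁻¹ := by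
  obtain ⟨C, hC0, hC⟩ := exists_norm_le_of_homogeneous
    (hg.continuousOn_fderiv_of_isOpen isOpen_compl_singleton le_rfl) (fderiv_homogeneous hom)
  -- Mean value inequality on the ball of radius `‖w‖ / 2` about `w`: points there have norm above
  -- `‖w‖ / 2`, which costs the factor `2 ^ (k + 1)`.
  refine ⟨C * 2 ^ (k + 1), by positivity, fun z w hzw => ?_⟩
  have hw : 0 < ‖w‖ := by linarith [norm_nonneg z]
  have hne : ∀ x ∈ Metric.ball w (‖w‖ / 2), x ≠ 0 := fun x hx =>
    norm_pos_iff.1 (by linarith [half_norm_lt_of_mem_ball hx])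
  have := (convex_ball w (‖w‖ / 2)).norm_image_sub_le_of_norm_fderiv_le (𝕜 := ℝ) (f := g)
    (C := C * 2 ^ (k + 1) * (‖w‖ ^ (k + 1))⁻¹) (x := w) (y := w + z)
    (fun x hx => (hg.differentiableOn one_ne_zero).differentiableAt
      (isOpen_compl_singleton.mem_nhds (hne x hx)))
    (fun x hx => by
      refine (hC x (hne x hx)).trans ?_
      rw [mul_assoc]
      gcongr
      have h1 := half_norm_lt_of_mem_ball hx
      calc (‖x‖ ^ (k + 1))⁻¹ ≤ ((‖w‖ / 2) ^ (k + 1))⁻¹ := by gcongr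
        _ = _ := by rw [div_pow, inv_div, div_eq_mul_inv])
    (Metric.mem_ball_self (by positivity)) (by simp [Metric.mem_ball]; linarith)
  refine this.trans_eq ?_
  rw [add_sub_cancel_left]; ring

namespace Octonion

/-! ### The Cauchy kernel and its derivative -/

/-- The derivative of the Cauchy kernel. -/
noncomputable def kernelDeriv (w : Octonion) : Octonion →L[ℝ] Octonion :=
  (‖w‖ ^ 8)⁻¹ • conjL - (8 * (‖w‖ ^ 10)⁻¹) • (innerSL ℝ w).smulRight (conj w)

theorem kernelDeriv_apply (w z : Octonion) : kernelDeriv w z =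
    (‖w‖ ^ 8)⁻¹ • conj z - (8 * (‖w‖ ^ 10)⁻¹ * inner ℝ w z) • conj w := by
  simp [kernelDeriv, smul_smul]

/-- This default value at the pole lets the lattice sums include `w = 0`. -/
theorem kernelDeriv_zero : kernelDeriv 0 = 0 := by
  ext1 z; simp [kernelDeriv_apply]

theorem hasFDerivAt_q0 {w : Octonion} (hw : w ≠ 0) : HasFDerivAt q0 (kernelDeriv w) w := by
  have h1 : HasFDerivAt (fun x : Octonion => ‖x‖ ^ 2) (2 • innerSL ℝ w) w :=
    (hasStrictFDerivAt_norm_sq w).hasFDerivAt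
  have hw' : ‖w‖ ≠ 0 := norm_ne_zero_iff.2 hw
  have h2 := (((hasDerivAt_inv (x := (‖w‖ ^ 2) ^ 4) (by positivity)).comp_hasFDerivAt w
    (h1.pow 4))).smul conjL.hasFDerivAt
  refine (h2.congr_of_eventuallyEq (Filter.Eventually.of_forall fun x => ?_)).congr_fderiv ?_
  · simp [q0, ← pow_mul]
  · ext1 z
    simp [kernelDeriv_apply, smul_smul]
    rw [sub_eq_add_neg, ← neg_smul]
    congr 2
    · ring
    · field_simp
      rw [← neg_smul]
      congr 1
      ring

theorem q_eq_kernelDeriv {w : Octonion} (hw : w ≠ 0) (i : Fin 8) : q i w = kernelDeriv w (e i) :=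
  ((hasFDerivAt_q0 hw).hasLineDerivAt (e i)).lineDeriv

theorem eq_sum_smul_e (z : Octonion) : z = ∑ i, z i • e i := by
  ext j; fin_cases j <;> simp [Fin.sum_univ_eight, e]

theorem inner_e (w : Octonion) (i : Fin 8) : inner ℝ w (e i) = w i := by
  simp [e, EuclideanSpace.inner_single_right]

theorem self_mul_conj (w : Octonion) : w * conj w = N w • e 0 := by
  ext j; fin_cases j <;> simp [N_eq, e, mul_apply, conj] <;> ring

theorem sum_e_mul_conj_e : ∑ i, e i * conj (e i) = (8 : ℝ) • e 0 := by
  have h : ∀ i, e i * conj (e i) = e 0 := fun i => by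
    rw [self_mul_conj, N_eq_norm_sq, e, PiLp.norm_single]; simp
  simp [h, ← Nat.cast_smul_eq_nsmul ℝ]

/-- The Cauchy kernel is left monogenic. -/
theorem sum_e_mul_kernelDeriv (w : Octonion) : ∑ i, e i * kernelDeriv w (e i) = 0 := by
  have h : ∀ i, e i * kernelDeriv w (e i) = (‖w‖ ^ 8)⁻¹ • (e i * conj (e i)) -
      (8 * (‖w‖ ^ 10)⁻¹) • ((w i • e i) * conj w) := fun i => by
    rw [kernelDeriv_apply, inner_e, ← mulBilin_apply (e i), map_sub, mulBilin_apply,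
      mulBilin_apply, mul_smul', mul_smul', smul_mul', smul_smul]
  rw [Finset.sum_congr rfl fun i _ => h i, Finset.sum_sub_distrib, ← Finset.smul_sum,
    ← Finset.smul_sum, ← sum_mul', ← eq_sum_smul_e, sum_e_mul_conj_e, self_mul_conj,
    smul_smul, smul_smul, N_eq_norm_sq, ← sub_smul]
  by_cases hw : w = 0
  · simp [hw]
  · have : ‖w‖ ≠ 0 := norm_ne_zero_iff.2 hw
    rw [show (‖w‖ ^ 8)⁻¹ * 8 - 8 * (‖w‖ ^ 10)⁻¹ * ‖w‖ ^ 2 = 0 by field_simp; ring, zero_smul]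

/-- The `j = 0` term vanishes and may be added. The coefficient of `z 0` is then `∑ e j * ∂ⱼ q0`,
which is zero by monogenicity, and what is left is the directional derivative. -/
theorem sum_V_mul_q {w : Octonion} (hw : w ≠ 0) (z : Octonion) :
    ∑ j ∈ Finset.univ.erase (0 : Fin 8), V j z * q j w = kernelDeriv w z := by
  have h : ∀ j, V j z * q j w = z j • kernelDeriv w (e j) - z 0 • (e j * kernelDeriv w (e j)) :=
    fun j => by
      rw [q_eq_kernelDeriv hw, V, sub_eq_add_neg, ← neg_smul, add_mul', smul_mul', smul_mul',
        e_zero_mul, neg_smul, ← sub_eq_add_neg]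
  have h0 : V 0 z * q 0 w = 0 := by rw [h, e_zero_mul, sub_self]
  have h1 := Finset.sum_erase_add Finset.univ (fun j => V j z * q j w) (Finset.mem_univ 0)
  rw [h0, add_zero] at h1
  rw [h1, Finset.sum_congr rfl fun j _ => h j, Finset.sum_sub_distrib, ← Finset.smul_sum,
    sum_e_mul_kernelDeriv, smul_zero, sub_zero]
  conv_rhs => rw [eq_sum_smul_e z, map_sum]
  simp

theorem zetaTerm_eq {w : Octonion} (hw : w ≠ 0) (z : Octonion) :
    zetaTerm z w = q0 (z + w) - q0 w - kernelDeriv w z := by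
  rw [zetaTerm, sum_V_mul_q hw]

theorem kernelDeriv_smul (t : ℝ) (ht : 0 < t) (x : Octonion) :
    kernelDeriv (t • x) = (t ^ 8)⁻¹ • kernelDeriv x := by
  ext1 z
  rw [_root_.smul_apply, kernelDeriv_apply, kernelDeriv_apply, ← conjL_apply (t • x),
    map_smul, conjL_apply, smul_sub, smul_smul, smul_smul, smul_smul, norm_smul,
    Real.norm_of_nonneg ht.le, mul_pow, mul_pow, real_inner_smul_left]
  congr 2
  · ring
  · field_simp

theorem contDiffOn_kernelDeriv : ContDiffOn ℝ 1 kernelDeriv {0}ᶜ := by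
  intro w hw
  have h : ContDiffAt ℝ 1 (fun x : Octonion => ‖x‖) w := contDiffAt_norm ℝ hw
  have hw' : ‖w‖ ≠ 0 := norm_ne_zero_iff.2 hw
  refine ContDiffAt.contDiffWithinAt ?_
  refine ContDiffAt.sub (((h.pow 8).inv (by positivity)).smul contDiffAt_const)
    (((contDiffAt_const.mul ((h.pow 10).inv (by positivity)))).smul ?_)
  exact ContDiffAt.smulRight (innerSL ℝ).contDiff.contDiffAt conjL.contDiff.contDiffAt

theorem exists_kernelDeriv_le : ∃ C, 0 ≤ C ∧ ∀ z w, 2 * ‖z‖ < ‖w‖ →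
    ‖kernelDeriv (z + w) - kernelDeriv w‖ ≤ C * ‖z‖ * (‖w‖ ^ 9)⁻¹ := by
  simpa only [add_comm] using
    exists_norm_add_sub_le_of_homogeneous contDiffOn_kernelDeriv kernelDeriv_smul

/-- The mean value inequality compares the derivative along the segment with its value at `w`, so
the increment bound for `kernelDeriv` suffices. -/
theorem exists_q0_taylor_le : ∃ C, 0 ≤ C ∧ ∀ z w, 2 * ‖z‖ < ‖w‖ →
    ‖q0 (z + w) - q0 w - kernelDeriv w z‖ ≤ C * ‖z‖ ^ 2 * (‖w‖ ^ 9)⁻¹ := by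
  obtain ⟨C, hC0, hC⟩ := exists_kernelDeriv_le
  refine ⟨C, hC0, fun z w hzw => ?_⟩
  have hseg : ∀ x ∈ segment ℝ w (z + w), ‖x - w‖ ≤ ‖z‖ := fun x hx => by
    simpa using norm_sub_le_of_mem_segment hx
  have := (convex_segment w (z + w)).norm_image_sub_le_of_norm_hasFDerivWithin_le' (𝕜 := ℝ)
    (f := q0) (f' := kernelDeriv) (φ := kernelDeriv w) (C := C * ‖z‖ * (‖w‖ ^ 9)⁻¹)
    (x := w) (y := z + w)
    (fun x hx => (hasFDerivAt_q0 (norm_pos_iff.1 (by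
      have h1 := hseg x hx
      rw [norm_sub_rev] at h1
      linarith [norm_sub_norm_le w x, norm_nonneg z]))).hasFDerivWithinAt)
    (fun x hx => by
      have h1 := hseg x hx
      have h2 := hC (x - w) w (by linarith)
      rw [sub_add_cancel] at h2
      refine h2.trans ?_
      gcongr)
    (left_mem_segment _ _ _) (right_mem_segment _ _ _)
  rw [add_sub_cancel_right] at this
  exact this.trans_eq (by ring)

theorem q0_sandwich {x y : Octonion} (hx : x ≠ 0) (hy : y ≠ 0) (z : Octonion) :
    (N x * N y) ^ 3 • sandwich y x (q0 (sandwich x y z)) = q0 z := by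
  have h := (mul_pos (N_pos hx) (N_pos hy)).ne'
  rw [q0, q0, map_smul, sandwich_conj_sandwich, smul_smul, smul_smul,
    show ‖sandwich x y z‖ ^ 8 = (‖sandwich x y z‖ ^ 2) ^ 4 by ring, norm_sq_sandwich]
  generalize N x * N y = c at *
  congr 1
  rw [mul_pow, mul_inv, ← pow_mul]
  field_simp

theorem kernelDeriv_sandwich {x y : Octonion} (hx : x ≠ 0) (hy : y ≠ 0) (w z : Octonion) :
    (N x * N y) ^ 3 • sandwich y x (kernelDeriv (sandwich x y w) (sandwich x y z)) =
      kernelDeriv w z := by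
  have h := (mul_pos (N_pos hx) (N_pos hy)).ne'
  rw [kernelDeriv_apply, kernelDeriv_apply, map_sub, map_smul, map_smul, sandwich_conj_sandwich,
    sandwich_conj_sandwich, smul_sub, smul_smul, smul_smul, smul_smul, smul_smul, inner_sandwich,
    show ‖sandwich x y w‖ ^ 8 = (‖sandwich x y w‖ ^ 2) ^ 4 by ring,
    show ‖sandwich x y w‖ ^ 10 = (‖sandwich x y w‖ ^ 2) ^ 5 by ring, norm_sq_sandwich]
  generalize N x * N y = c at *
  rw [mul_pow, mul_pow, mul_inv, mul_inv, ← pow_mul, ← pow_mul]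
  congr 2 <;> field_simp

end Octonion

open Filter Topology Bornology Module

/-! ### Lattice sums -/

/-! ### Telescoping sums along a basis direction -/

theorem tsum_int_sub_eq_zero {E : Type*} [NormedAddCommGroup E] {f : ℤ → E}
    (hf : Tendsto f cofinite (𝓝 0)) (hs : Summable fun k => f (k + 1) - f k) :
    ∑' k, (f (k + 1) - f k) = 0 := by
  have h1 := hs.hasSum.comp (Finset.tendsto_Ico_neg (R := ℤ))
  rw [Int.cofinite_eq, tendsto_sup] at hf
  have h2 : Tendsto (fun n : ℕ => f n - f (-n)) atTop (𝓝 (0 - 0)) :=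
    (hf.2.comp tendsto_natCast_atTop_atTop).sub
      (hf.1.comp (tendsto_neg_atTop_atBot.comp tendsto_natCast_atTop_atTop))
  rw [sub_zero] at h2
  refine tendsto_nhds_unique h1 (h2.congr fun n => ?_)
  have h3 := Finset.sum_Ico_int_sub n fun k => -f k
  simp only [neg_sub_neg] at h3
  exact h3.symm

theorem tsum_sub_basis_eq_zero {Λ E : Type*} [AddCommGroup Λ] [NormedAddCommGroup E]
    [CompleteSpace E] {n : ℕ} (β : Basis (Fin (n + 1)) ℤ Λ) (h : Fin (n + 1)) {f : Λ → E}
    (hf : Tendsto f cofinite (𝓝 0)) (hs : Summable fun w => f (w + β h) - f w) :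
    ∑' w, (f (w + β h) - f w) = 0 := by
  -- Split off the `h`-th coordinate: translation by `β h` shifts it by one, so each fibre sum
  -- telescopes.
  let φ : (Fin n → ℤ) × ℤ ≃ Λ := (Equiv.prodComm _ _).trans
    ((Fin.insertNthEquiv (fun _ => ℤ) h).trans β.equivFun.symm.toEquiv)
  have hφ : ∀ m k, φ (m, k) + β h = φ (m, k + 1) := fun m k => by
    have h1 : β h = β.equivFun.symm (Pi.single h 1) := by simp
    have h2 : h.insertNth (α := fun _ => ℤ) (k + 1) m =
        h.insertNth (α := fun _ => ℤ) k m + Pi.single h 1 := by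
      ext i
      induction i using Fin.succAboveCases h <;> simp
    change β.equivFun.symm (h.insertNth (α := fun _ => ℤ) k m) + β h =
      β.equivFun.symm (h.insertNth (α := fun _ => ℤ) (k + 1) m)
    rw [h2, map_add, h1]
  rw [← φ.tsum_eq]
  have hs' := (φ.summable_iff.2 hs)
  simp only [Function.comp_def] at hs'
  rw [hs'.tsum_prod]
  refine (tsum_congr fun m => ?_).trans tsum_zero
  have h1 := hs'.prod_factor m
  simp only [hφ] at h1 ⊢
  refine tsum_int_sub_eq_zero (f := fun k => f (φ (m, k))) (hf.comp ?_) h1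
  exact (φ.injective.comp (Prod.mk_right_injective m)).tendsto_cofinite

namespace Octonion

open Submodule (span)

/-! ### Convergence of the lattice series -/

theorem finite_norm_le (b : Basis (Fin 8) ℝ Octonion) (R : ℝ) :
    {w : span ℤ (Set.range b) | ‖(w : Octonion)‖ ≤ R}.Finite := by
  refine Set.Finite.of_finite_image ((ZSpan.setFinite_inter b
    (Metric.isBounded_closedBall (x := 0) (r := R))).subset ?_)
    Subtype.val_injective.injOn
  rintro _ ⟨w, hw, rfl⟩
  exact ⟨by simpa using hw, w.2⟩

theorem tendsto_norm_lattice (b : Basis (Fin 8) ℝ Octonion) :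
    Tendsto (fun w : span ℤ (Set.range b) => ‖(w : Octonion)‖) cofinite atTop :=
  tendsto_atTop.2 fun R => (finite_norm_le b R).subset fun w hw => by
    simp only [Set.mem_compl_iff, Set.mem_ofPred_eq, not_le] at hw ⊢
    exact hw.le

/-- Decay of order 9 exceeds the lattice rank 8. -/
theorem summable_lattice_of_norm_le {G : Type*} [NormedAddCommGroup G] [CompleteSpace G]
    (b : Basis (Fin 8) ℝ Octonion) {F : Octonion → G} {K R : ℝ}
    (hF : ∀ w, R < ‖w‖ → ‖F w‖ ≤ K * (‖w‖ ^ 9)⁻¹) :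
    Summable fun w : span ℤ (Set.range b) => F w := by
  have h1 : finrank ℤ (span ℤ (Set.range b)) = 8 := by
    rw [ZLattice.rank ℝ, finrank_euclideanSpace_fin]
  have h2 := (ZLattice.summable_norm_zpow (span ℤ (Set.range b)) (-9)
    (by rw [h1]; norm_num)).mul_left K
  refine Summable.of_norm_bounded_eventually h2 ?_
  filter_upwards [(tendsto_norm_lattice b).eventually_gt_atTop R] with w hw
  exact hF w hw

theorem summable_zeta (b : Basis (Fin 8) ℝ Octonion) (z : Octonion) :
    Summable fun w : span ℤ (Set.range b) => q0 (z + w) - q0 w - kernelDeriv w z := by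
  obtain ⟨C, -, hC⟩ := exists_q0_taylor_le
  exact summable_lattice_of_norm_le b (F := fun w => q0 (z + w) - q0 w - kernelDeriv w z)
    (fun w hw => hC z w hw)

theorem summable_wp (b : Basis (Fin 8) ℝ Octonion) (z : Octonion) :
    Summable fun w : span ℤ (Set.range b) => kernelDeriv (z + w) - kernelDeriv w := by
  obtain ⟨C, -, hC⟩ := exists_kernelDeriv_le
  exact summable_lattice_of_norm_le b (F := fun w => kernelDeriv (z + w) - kernelDeriv w)
    (fun w hw => hC z w hw)

/-- The `ζ`-function as a single sum over the lattice spanned by `b`. -/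
noncomputable def zetaSum (b : Basis (Fin 8) ℝ Octonion) (z : Octonion) : Octonion :=
  ∑' w : span ℤ (Set.range b), (q0 (z + w) - q0 w - kernelDeriv w z)

/-- The linear map `x ↦ ∑ xᵢ ℘ᵢ(z)`. -/
noncomputable def wpSum (b : Basis (Fin 8) ℝ Octonion) (z : Octonion) : Octonion →L[ℝ] Octonion :=
  ∑' w : span ℤ (Set.range b), (kernelDeriv (z + w) - kernelDeriv w)

theorem q0_zero : q0 0 = 0 := by simp [q0]

theorem zetaSum_zero (b : Basis (Fin 8) ℝ Octonion) : zetaSum b 0 = 0 := by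
  simp [zetaSum]

theorem wpSum_zero (b : Basis (Fin 8) ℝ Octonion) : wpSum b 0 = 0 := by
  simp [wpSum]

theorem norm_q0 (x : Octonion) : ‖q0 x‖ = (‖x‖ ^ 7)⁻¹ := by
  rw [q0, norm_smul, norm_conj, norm_inv, norm_pow, norm_norm]
  by_cases h : ‖x‖ = 0
  · simp [h]
  · field_simp

theorem tendsto_q0_lattice (b : Basis (Fin 8) ℝ Octonion) (z : Octonion) :
    Tendsto (fun w : span ℤ (Set.range b) => q0 (z + w)) cofinite (𝓝 0) := by
  rw [tendsto_zero_iff_norm_tendsto_zero]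
  simp only [norm_q0]
  refine (tendsto_inv_atTop_zero).comp ((tendsto_pow_atTop (by norm_num)).comp ?_)
  refine tendsto_atTop_mono (fun w => ?_)
    (tendsto_atTop_add_const_right _ (-‖z‖) (tendsto_norm_lattice b))
  have := norm_sub_le (z + w) z
  rw [add_sub_cancel_left] at this
  linarith

/-! ### Quasi-periodicity of `ζ` -/

theorem zetaSum_add_basis (b : Basis (Fin 8) ℝ Octonion) (z : Octonion) (h : Fin 8) :
    zetaSum b (z + b h) - zetaSum b z = zetaSum b (b h) := by
  have h1 := summable_zeta b (z + b h)
  have h2 := summable_zeta b z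
  have h3 := summable_zeta b (b h)
  let f : span ℤ (Set.range b) → Octonion := fun w => q0 (z + w) - q0 (0 + w)
  have hf : Tendsto f cofinite (𝓝 0) := by
    simpa [f] using (tendsto_q0_lattice b z).sub (tendsto_q0_lattice b 0)
  -- The linear terms cancel, leaving a difference of `f` that telescopes to zero. The poles need no
  -- exception, so `z` may be a lattice point.
  have key : ∀ w : span ℤ (Set.range b), (q0 (z + b h + w) - q0 w - kernelDeriv w (z + b h)) -
      (q0 (z + w) - q0 w - kernelDeriv w z) - (q0 (b h + w) - q0 w - kernelDeriv w (b h)) =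
      f (w + b.restrictScalars ℤ h) - f w := fun w => by
    simp only [f, Submodule.coe_add, Basis.restrictScalars_apply, map_add, zero_add]
    rw [add_comm (w : Octonion) (b h), ← add_assoc]
    abel
  have h4 := (h1.sub h2).sub h3
  simp only [key] at h4
  have h5 := tsum_sub_basis_eq_zero (b.restrictScalars ℤ) h hf h4
  rw [← tsum_congr key, ((h1.sub h2).tsum_sub h3), h1.tsum_sub h2] at h5
  exact sub_eq_zero.1 h5

theorem zetaSum_add_sum (b : Basis (Fin 8) ℝ Octonion) (z : Octonion) (n : Fin 8 → ℤ) :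
    zetaSum b (z + ∑ j, n j • b j) - zetaSum b z = ∑ j, n j • zetaSum b (b j) := by
  have h1 : ∀ (j : Fin 8) (m : ℤ) (z : Octonion),
      zetaSum b (z + m • b j) - zetaSum b z = m • zetaSum b (b j) := fun j m => by
    induction m using Int.induction_on with
    | zero => simp
    | succ i hi =>
      intro z
      rw [add_zsmul, one_zsmul, ← add_assoc, ← sub_add_sub_cancel _ (zetaSum b (z + i • b j)),
        ← natCast_zsmul, hi, zetaSum_add_basis, add_zsmul, one_zsmul, add_comm]
    | pred i hi =>
      intro z
      have h2 := zetaSum_add_basis b (z + (-i - 1 : ℤ) • b j) j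
      rw [add_assoc, show (-i - 1 : ℤ) • b j + b j = (-i : ℤ) • b j by
        rw [sub_zsmul, one_zsmul, neg_add_cancel_right]] at h2
      rw [sub_zsmul (zetaSum b (b j)), one_zsmul, ← hi z, ← h2]
      abel
  have h2 : ∀ (s : Finset (Fin 8)) (z : Octonion),
      zetaSum b (z + ∑ j ∈ s, n j • b j) - zetaSum b z = ∑ j ∈ s, n j • zetaSum b (b j) := by
    intro s
    induction s using Finset.induction_on with
    | empty => simp
    | insert j s hj hs =>
      intro z
      rw [Finset.sum_insert hj, Finset.sum_insert hj, ← add_assoc,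
        ← sub_add_sub_cancel _ (zetaSum b (z + n j • b j)), hs, h1, add_comm]
  exact h2 _ z

end Octonion

theorem Summable.continuousLinearMap_apply {ι E F : Type*} [NormedAddCommGroup E] [NormedSpace ℝ E]
    [NormedAddCommGroup F] [NormedSpace ℝ F] {f : ι → E →L[ℝ] F} (hf : Summable f) (x : E) :
    Summable fun i => f i x :=
  (ContinuousLinearMap.apply ℝ F x).summable hf

theorem Summable.tsum_continuousLinearMap_apply {ι E F : Type*} [NormedAddCommGroup E]
    [NormedSpace ℝ E] [NormedAddCommGroup F] [NormedSpace ℝ F] {f : ι → E →L[ℝ] F}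
    (hf : Summable f) (x : E) : (∑' i, f i) x = ∑' i, f i x :=
  (ContinuousLinearMap.apply ℝ F x).map_tsum hf

namespace Octonion

open Submodule (span)

theorem summable_wp_apply (b : Basis (Fin 8) ℝ Octonion) (z x : Octonion) :
    Summable fun w : span ℤ (Set.range b) => (kernelDeriv (z + w) - kernelDeriv w) x :=
  (summable_wp b z).continuousLinearMap_apply x

theorem wpSum_apply (b : Basis (Fin 8) ℝ Octonion) (z x : Octonion) :
    wpSum b z x = ∑' w : span ℤ (Set.range b), (kernelDeriv (z + w) - kernelDeriv w) x :=
  (summable_wp b z).tsum_continuousLinearMap_apply x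

/-! ### Division points -/

section Division

variable (b : Basis (Fin 8) ℝ Octonion) (M : Octonion ≃ₗ[ℝ] Octonion)

theorem mem_span_map_symm_iff (u : Octonion) :
    u ∈ span ℤ (Set.range (b.map M.symm)) ↔ M u ∈ span ℤ (Set.range b) := by
  simp [Basis.mem_span_iff_repr_mem]

/-- The points of the fundamental domain of `b` which `M` maps into the lattice. -/
def divisionSet : Set Octonion :=
  {v | v ∈ ZSpan.fundamentalDomain b ∧ M v ∈ span ℤ (Set.range b)}

theorem finite_divisionSet : (divisionSet b M).Finite :=
  (ZSpan.setFinite_inter (b.map M.symm) (ZSpan.fundamentalDomain_isBounded b)).subset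
    fun _ hv => ⟨hv.1, (mem_span_map_symm_iff b M _).2 hv.2⟩

variable {b M} (hM : ∀ w ∈ span ℤ (Set.range b), M w ∈ span ℤ (Set.range b))
include hM

theorem fract_mem_divisionSet {u : Octonion} (hu : M u ∈ span ℤ (Set.range b)) :
    ZSpan.fract b u ∈ divisionSet b M := by
  refine ⟨ZSpan.fract_mem_fundamentalDomain b u, ?_⟩
  rw [ZSpan.fract_apply, map_sub]
  exact Submodule.sub_mem _ hu (hM _ (ZSpan.floor b u).2)

/-- Each point which `M` maps into the lattice is uniquely a division point plus a lattice
point. -/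
noncomputable def divisionEquiv : divisionSet b M × span ℤ (Set.range b) ≃
    span ℤ (Set.range (b.map M.symm)) where
  toFun p := ⟨p.1 + p.2, (mem_span_map_symm_iff b M _).2 (by
    rw [map_add]; exact Submodule.add_mem _ p.1.2.2 (hM _ p.2.2))⟩
  invFun u := (⟨ZSpan.fract b u,
    fract_mem_divisionSet hM ((mem_span_map_symm_iff b M _).1 u.2)⟩, ZSpan.floor b u)
  left_inv p := by
    have h : ZSpan.fract b (p.1 + p.2 : Octonion) = p.1 := by
      rw [ZSpan.fract_add_ZSpan b _ p.2.2]; exact ZSpan.fract_eq_self.2 p.1.2.1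
    refine Prod.ext (Subtype.ext h) (Subtype.ext ?_)
    rw [ZSpan.fract_apply, sub_eq_iff_eq_add] at h
    exact (add_left_cancel h).symm
  right_inv u := Subtype.ext (by simp [ZSpan.fract_apply])

theorem divisionEquiv_apply (p : divisionSet b M × span ℤ (Set.range b)) :
    (divisionEquiv hM p : Octonion) = p.1 + p.2 := rfl

/-- Division points represent the cosets of `Λ` in `M⁻¹ Λ`, and the index of a sublattice is the
ratio of covolumes. -/
theorem card_divisionSet : (Nat.card (divisionSet b M) : ℝ) =
    |LinearMap.det (M : Octonion →ₗ[ℝ] Octonion)| := by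
  have hle : span ℤ (Set.range b) ≤ span ℤ (Set.range (b.map M.symm)) := fun w hw =>
    (mem_span_map_symm_iff b M _).2 (hM w hw)
  have h1 : Nat.card (divisionSet b M) = (span ℤ (Set.range b)).toAddSubgroup.relIndex
      (span ℤ (Set.range (b.map M.symm))).toAddSubgroup := by
    refine Nat.card_eq_of_bijective (fun v => QuotientAddGroup.mk
      ⟨v, (mem_span_map_symm_iff b M _).2 v.2.2⟩) ⟨fun v v' hv => ?_, fun u => ?_⟩
    · rw [QuotientAddGroup.eq, AddSubgroup.mem_addSubgroupOf] at hv
      refine Subtype.ext ?_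
      rw [← ZSpan.fract_eq_self.2 v.2.1, ← ZSpan.fract_eq_self.2 v'.2.1, ZSpan.fract_eq_fract]
      exact hv
    · induction u using QuotientAddGroup.induction_on with
      | H u =>
        refine ⟨⟨ZSpan.fract b u,
          fract_mem_divisionSet hM ((mem_span_map_symm_iff b M _).1 u.2)⟩, ?_⟩
        rw [QuotientAddGroup.eq, AddSubgroup.mem_addSubgroupOf]
        have h : -ZSpan.fract b u + u = (ZSpan.floor b u : Octonion) := by
          rw [ZSpan.fract_apply]; abel
        change -ZSpan.fract b u + u ∈ span ℤ (Set.range b)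
        rw [h]
        exact (ZSpan.floor b u).2
  have h2 := ZLattice.covolume_div_covolume_eq_relIndex' _ _ hle
  have h3 := ZLattice.covolume_ne_zero (span ℤ (Set.range (b.map M.symm)))
    (MeasureTheory.volume)
  rw [h1, ← h2]
  rw [ZLattice.covolume_eq_measure_fundamentalDomain _ _
    (ZSpan.isAddFundamentalDomain _ MeasureTheory.volume)] at h3
  rw [ZLattice.covolume_eq_measure_fundamentalDomain _ _
    (ZSpan.isAddFundamentalDomain b MeasureTheory.volume),
    ZLattice.covolume_eq_measure_fundamentalDomain _ _
    (ZSpan.isAddFundamentalDomain (b.map M.symm) MeasureTheory.volume),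
    ZSpan.measureReal_fundamentalDomain b _ (b.map M.symm), mul_div_cancel_right₀ _ h3,
    Basis.det_map]
  congr 1
  have := b.det_comp (M : Octonion →ₗ[ℝ] Octonion) b
  rw [Basis.det_self, mul_one] at this
  exact this

/-- For `u = v + w`, the remainder at `u` is the `ζ`-remainder at `z + v`, minus that at `v`, minus
`(K (v + w) - K w) z`, where `K` is `kernelDeriv`. Each piece is summable over `w`. -/
theorem tsum_division (z : Octonion) :
    ∑' u : span ℤ (Set.range (b.map M.symm)), (q0 (z + u) - q0 u - kernelDeriv u z) =
      ∑ v ∈ (finite_divisionSet b M).toFinset, (zetaSum b (z + v) - zetaSum b v - wpSum b v z) := by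
  have : Fintype (divisionSet b M) := (finite_divisionSet b M).fintype
  have hs := (divisionEquiv hM).summable_iff.2 (summable_zeta (b.map M.symm) z)
  rw [← (divisionEquiv hM).tsum_eq]
  simp only [Function.comp_def, divisionEquiv_apply] at hs
  simp only [divisionEquiv_apply]
  rw [hs.tsum_prod, tsum_fintype, Finset.sum_subtype _ fun v => Set.Finite.mem_toFinset _]
  refine Finset.sum_congr rfl fun v _ => ?_
  have h1 := summable_zeta b (z + v)
  have h2 := summable_zeta b v
  rw [wpSum_apply, zetaSum, zetaSum, ← h1.tsum_sub h2,
    ← (h1.sub h2).tsum_sub (summable_wp_apply b v z)]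
  refine tsum_congr fun w => ?_
  rw [sub_apply, map_add, add_assoc]
  abel

end Division

/-- The transformation of the `ζ`-function under `z ↦ x (z y)`. -/
theorem smul_sandwich_zetaSum {x y : Octonion} (hx : x ≠ 0) (hy : y ≠ 0)
    {b : Basis (Fin 8) ℝ Octonion} {M : Octonion ≃ₗ[ℝ] Octonion}
    (hMxy : ∀ z, M z = sandwich x y z)
    (hM : ∀ w ∈ span ℤ (Set.range b), M w ∈ span ℤ (Set.range b)) (z : Octonion) :
    (N x * N y) ^ 3 • sandwich y x (zetaSum b (sandwich x y z)) =
      ∑ v ∈ (finite_divisionSet b M).toFinset,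
        (zetaSum b (z + v) - zetaSum b v - wpSum b v z) := by
  rw [← tsum_division hM, zetaSum]
  let T : Octonion →L[ℝ] Octonion := (N x * N y) ^ 3 • sandwich y x
  have hT : ∀ u, (N x * N y) ^ 3 • sandwich y x u = T u := fun _ => rfl
  let φ : span ℤ (Set.range (b.map M.symm)) ≃ span ℤ (Set.range b) :=
    M.toEquiv.subtypeEquiv fun u => mem_span_map_symm_iff b M u
  rw [hT, T.map_tsum (summable_zeta b _), ← φ.tsum_eq]
  refine tsum_congr fun u => ?_
  have hu : (φ u : Octonion) = sandwich x y u := hMxy u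
  rw [hu, ← map_add, map_sub, map_sub, ← hT, ← hT, ← hT, q0_sandwich hx hy, q0_sandwich hx hy,
    kernelDeriv_sandwich hx hy]

/-- The values of the functions `℘` at the division points, summed, in terms of the quasiperiods of
the `ζ`-function. -/
theorem sum_wpSum_apply_basis {x y : Octonion} (hx : x ≠ 0) (hy : y ≠ 0)
    {b : Basis (Fin 8) ℝ Octonion} {M : Octonion ≃ₗ[ℝ] Octonion}
    (hMxy : ∀ z, M z = sandwich x y z)
    (hM : ∀ w ∈ span ℤ (Set.range b), M w ∈ span ℤ (Set.range b)) {n : Fin 8 → ℤ} {h : Fin 8}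
    (hn : sandwich x y (b h) = ∑ j, n j • b j) :
    ∑ v ∈ (finite_divisionSet b M).toFinset, wpSum b v (b h) =
      -((N x * N y) ^ 3) • (sandwich y x (∑ j, n j • zetaSum b (b j)) -
        (N x * N y) • zetaSum b (b h)) := by
  have hcard : ((finite_divisionSet b M).toFinset.card : ℝ) = (N x * N y) ^ 4 := by
    rw [← Nat.card_eq_card_finite_toFinset, card_divisionSet hM, ← abs_det_sandwich]
    congr 2
    ext1 z
    exact hMxy z
  -- At a period, `ζ (z + v) - ζ v` is the same for every `v`, so the sum over `v` contributes `c ^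
  -- 4` copies of the quasi-period, with `c = N x * N y`.
  have h0 := smul_sandwich_zetaSum hx hy hMxy hM (b h)
  have h1 := zetaSum_add_sum b 0 n
  rw [zero_add, zetaSum_zero, sub_zero] at h1
  rw [hn, h1] at h0
  have h2 : ∀ v, zetaSum b (b h + v) - zetaSum b v - wpSum b v (b h) =
      zetaSum b (b h) - wpSum b v (b h) := fun v => by
    rw [add_comm (b h) v, zetaSum_add_basis]
  rw [Finset.sum_congr rfl fun v _ => h2 v, Finset.sum_sub_distrib, Finset.sum_const,
    ← Nat.cast_smul_eq_nsmul ℝ, hcard] at h0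
  rw [neg_smul, smul_sub, smul_smul, h0]
  module

/-! ### The elliptic functions as sums over the lattice -/

theorem lattice_eq {ω : Fin 8 → Octonion} {b : Basis (Fin 8) ℝ Octonion} (hb : ⇑b = ω) :
    lattice ω = (span ℤ (Set.range b) : Set Octonion) := by
  ext x
  rw [SetLike.mem_coe, Submodule.mem_span_range_iff_exists_fun, hb]
  simp only [lattice, Set.mem_ofPred_eq, eq_comm]

theorem fundamentalCell_eq {ω : Fin 8 → Octonion} {b : Basis (Fin 8) ℝ Octonion} (hb : ⇑b = ω) :
    fundamentalCell ω = ZSpan.fundamentalDomain b := by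
  ext x
  simp only [fundamentalCell, Set.mem_ofPred_eq, ZSpan.mem_fundamentalDomain, Set.mem_Ico, ← hb]
  constructor
  · rintro ⟨α, h, rfl⟩ i
    rw [Basis.repr_sum_self]
    exact h i
  · exact fun h => ⟨b.repr x, h, (b.sum_repr x).symm⟩

theorem divisionPoints_eq {ω : Fin 8 → Octonion} {b : Basis (Fin 8) ℝ Octonion} (hb : ⇑b = ω)
    {x y : Octonion} (hx : x ≠ 0) (hy : y ≠ 0) {M : Octonion ≃ₗ[ℝ] Octonion}
    (hMxy : ∀ z, M z = sandwich x y z) : divisionPoints ω x y = divisionSet b M := by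
  ext v
  simp only [divisionPoints, divisionSet, Set.mem_ofPred_eq, fundamentalCell_eq hb,
    lattice_eq hb, SetLike.mem_coe, sandwich_eq_iff hx hy, hMxy, exists_eq_right']

section Subtype

variable {ω : Fin 8 → Octonion} {b : Basis (Fin 8) ℝ Octonion} (hb : ⇑b = ω)
  {G : Type*} [NormedAddCommGroup G] [CompleteSpace G] {F : Octonion → G}
include hb

theorem summable_lattice_diff_zero (hF : Summable fun w : span ℤ (Set.range b) => F w) :
    Summable fun w : ↥(lattice ω \ {0}) => F w := by
  have hsub : ∀ w ∈ lattice ω \ {0}, w ∈ span ℤ (Set.range b) := fun w hw => by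
    have := hw.1
    rwa [lattice_eq hb] at this
  exact hF.comp_injective (i := fun w : ↥(lattice ω \ {0}) => ⟨w, hsub w w.2⟩)
    fun w w' h => Subtype.ext (Subtype.mk.inj h)

theorem add_tsum_lattice_diff_zero (hF : Summable fun w : span ℤ (Set.range b) => F w) :
    F 0 + ∑' w : ↥(lattice ω \ {0}), F w = ∑' w : span ℤ (Set.range b), F w := by
  subst hb
  have h0 : (0 : Octonion) ∈ lattice b := by rw [lattice_eq rfl]; exact zero_mem _
  have h1 := (summable_lattice_diff_zero rfl hF).hasSum
  have h2 : HasSum (fun w : ({0} : Set Octonion) => F w) (F 0) := by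
    simpa using hasSum_fintype fun w : ({0} : Set Octonion) => F w
  have h3 := h2.add_disjoint Set.disjoint_sdiff_right h1
  rw [Set.union_sdiff_self, Set.singleton_union, Set.insert_eq_of_mem h0] at h3
  rw [← h3.tsum_eq]
  exact ((Equiv.setCongr (lattice_eq (b := b) rfl).symm).tsum_eq fun w : lattice b => F w).symm

end Subtype

theorem summable_zetaTerm {ω : Fin 8 → Octonion} {b : Basis (Fin 8) ℝ Octonion} (hb : ⇑b = ω)
    (z : Octonion) : Summable fun w : ↥(lattice ω \ {0}) => zetaTerm z w :=
  (summable_lattice_diff_zero hb (F := fun w => q0 (z + w) - q0 w - kernelDeriv w z)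
    (summable_zeta b z)).congr fun w => (zetaTerm_eq w.2.2 z).symm

theorem zeta_eq {ω : Fin 8 → Octonion} {b : Basis (Fin 8) ℝ Octonion} (hb : ⇑b = ω)
    (z : Octonion) : zeta ω z = zetaSum b z := by
  rw [zeta, tsum_congr fun w => zetaTerm_eq w.2.2 z, zetaSum, ← add_tsum_lattice_diff_zero hb
    (F := fun w => q0 (z + w) - q0 w - kernelDeriv w z) (summable_zeta b z)]
  simp [q0_zero, kernelDeriv_zero]

theorem wpTerm_eq {ω : Fin 8 → Octonion} {b : Basis (Fin 8) ℝ Octonion} (hb : ⇑b = ω)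
    (i : Fin 8) {z w : Octonion} (hz : z ∉ lattice ω) (hw : w ∈ lattice ω \ {0}) :
    wpTerm i z w = (kernelDeriv (z + w) - kernelDeriv w) (e i) := by
  have hzw : z + w ≠ 0 := fun h => hz <| by
    have h1 := hw.1
    rw [lattice_eq hb] at h1 ⊢
    rw [eq_neg_of_add_eq_zero_left h]
    exact neg_mem h1
  rw [wpTerm, q_eq_kernelDeriv hzw, q_eq_kernelDeriv hw.2, sub_apply]

theorem summable_wpTerm {ω : Fin 8 → Octonion} {b : Basis (Fin 8) ℝ Octonion} (hb : ⇑b = ω)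
    (i : Fin 8) {z : Octonion} (hz : z ∉ lattice ω) :
    Summable fun w : ↥(lattice ω \ {0}) => wpTerm i z w :=
  (summable_lattice_diff_zero hb (F := fun w => (kernelDeriv (z + w) - kernelDeriv w) (e i))
    (summable_wp_apply b z (e i))).congr fun w => (wpTerm_eq hb i hz w.2).symm

theorem wp_eq {ω : Fin 8 → Octonion} {b : Basis (Fin 8) ℝ Octonion} (hb : ⇑b = ω) (i : Fin 8)
    {z : Octonion} (hz : z ∉ lattice ω) : wp ω i z = wpSum b z (e i) := by
  have hz0 : z ≠ 0 := fun h => hz <| by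
    rw [lattice_eq hb, h]; exact zero_mem _
  rw [wp, tsum_congr fun w : ↥(lattice ω \ {0}) => wpTerm_eq hb i hz w.2, wpSum_apply,
    ← add_tsum_lattice_diff_zero hb
    (F := fun w => (kernelDeriv (z + w) - kernelDeriv w) (e i)) (summable_wp_apply b z (e i)),
    q_eq_kernelDeriv hz0, kernelDeriv_zero, sub_zero, add_zero]

/-- Cramer's rule: `adjugate W * W = det W • 1`, applied to the expansion of each `ω h` in the `e
l`. -/
theorem sum_Θ_smul (ω : Fin 8 → Octonion) (A : Octonion →L[ℝ] Octonion) (i : Fin 8) :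
    ∑ h, Θ ω h i • A (ω h) = (periodMatrix ω).det • A (e i) := by
  have h1 : ∀ h, A (ω h) = ∑ l, periodMatrix ω h l • A (e l) := fun h => by
    conv_lhs => rw [eq_sum_smul_e (ω h), map_sum]
    simp [periodMatrix]
  simp only [h1, Finset.smul_sum, smul_smul, Θ]
  rw [Finset.sum_comm]
  simp only [← Finset.sum_smul, ← Matrix.mul_apply, Matrix.adjugate_mul, Matrix.smul_apply,
    Matrix.one_apply, smul_eq_mul, mul_ite, mul_one, mul_zero, ite_smul, zero_smul,
    Finset.sum_ite_eq, Finset.mem_univ, if_true]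

theorem det_periodMatrix_ne_zero {ω : Fin 8 → Octonion} (hω : LinearIndependent ℝ ω) :
    (periodMatrix ω).det ≠ 0 := by
  rw [← isUnit_iff_ne_zero, ← Matrix.isUnit_iff_isUnit_det,
    ← Matrix.linearIndependent_rows_iff_isUnit]
  exact hω.map' (EuclideanSpace.equiv (Fin 8) ℝ).toLinearMap
    (LinearEquiv.ker (EuclideanSpace.equiv (Fin 8) ℝ).toLinearEquiv)

end Octonion

/-! ### Assembly of the division value formula -/

theorem mainTheorem1 (ω : Fin 8 → Octonion) (hω : LinearIndependent ℝ ω)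
    (hω0 : ω 0 = Octonion.e 0) (lam mu : Octonion) (hlam0 : lam ≠ 0) (hmu0 : mu ≠ 0)
    (hlam : Octonion.IsLeftMultiplicator ω lam) (hmu : Octonion.IsRightMultiplicator ω mu) :
    -- the series for `ζ` and `℘_{τ(i)}` converge absolutely off the lattice
    (∀ z, z ∉ Octonion.lattice ω →
      (Summable fun w : ↥(Octonion.lattice ω \ {0}) => Octonion.zetaTerm z w) ∧
      ∀ i : Fin 8, i ≠ 0 →
        Summable fun w : ↥(Octonion.lattice ω \ {0}) => Octonion.wpTerm i z w) ∧
    -- the set of division points is finite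
    (Octonion.divisionPoints ω lam mu).Finite ∧
    -- `η` are the Legendre constants, `n` the coefficients of the multiplication by `lam`, `mu`
    ∃ (η : Fin 8 → Octonion) (n : Fin 8 → Fin 8 → ℤ),
      (∀ h z, z ∉ Octonion.lattice ω →
        Octonion.zeta ω (z + ω h) - Octonion.zeta ω z = η h) ∧
      (∀ h, lam * (ω h * mu) = ∑ j, n h j • ω j) ∧
      ∀ i : Fin 8, i ≠ 0 →
        ∑ᶠ v ∈ Octonion.divisionPoints ω lam mu \ {0}, Octonion.wp ω i v =
          -((Octonion.N lam * Octonion.N mu) ^ 3 / (Octonion.periodMatrix ω).det) •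
            (∑ h, Octonion.Θ ω h i • (mu * ((∑ j, n h j • η j) * lam)) -
              (Octonion.N lam * Octonion.N mu) • ∑ h, Octonion.Θ ω h i • η h) := by
  let b : Module.Basis (Fin 8) ℝ Octonion :=
    basisOfLinearIndependentOfCardEqFinrank hω (by simp)
  have hb : ⇑b = ω := coe_basisOfLinearIndependentOfCardEqFinrank hω _
  let M : Octonion ≃ₗ[ℝ] Octonion := LinearEquiv.ofInjectiveEndo
    (Octonion.sandwich lam mu : Octonion →ₗ[ℝ] Octonion)
    (Octonion.sandwich_injective hlam0 hmu0)
  have hMxy : ∀ z, M z = Octonion.sandwich lam mu z := fun _ => rfl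
  have hmem : ∀ w ∈ Octonion.lattice ω, Octonion.sandwich lam mu w ∈ Octonion.lattice ω :=
    fun w hw => hlam _ (hmu _ hw)
  have hM : ∀ w ∈ Submodule.span ℤ (Set.range b), M w ∈ Submodule.span ℤ (Set.range b) := by
    rw [Octonion.lattice_eq hb] at hmem
    exact hmem
  have hV := Octonion.divisionPoints_eq hb hlam0 hmu0 hMxy
  have hωmem : ∀ h, ω h ∈ Octonion.lattice ω := fun h => by
    rw [Octonion.lattice_eq hb, ← hb]
    exact Submodule.subset_span (Set.mem_range_self h)
  choose n hn using fun h => hmem _ (hωmem h)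
  have hzeta : ∀ z, Octonion.zeta ω z = Octonion.zetaSum b z := Octonion.zeta_eq hb
  refine ⟨fun z hz => ⟨Octonion.summable_zetaTerm hb z,
    fun i _ => Octonion.summable_wpTerm hb i hz⟩, hV ▸ Octonion.finite_divisionSet b M,
    fun h => Octonion.zetaSum b (ω h), n, fun h z _ => ?_, hn, fun i _ => ?_⟩
  · rw [hzeta, hzeta, ← hb, Octonion.zetaSum_add_basis]
  let S := (Octonion.finite_divisionSet b M).toFinset
  let A : Octonion →L[ℝ] Octonion := ∑ v ∈ S, Octonion.wpSum b v
  have hdet := Octonion.det_periodMatrix_ne_zero hω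
  have hsum : ∑ᶠ v ∈ Octonion.divisionPoints ω lam mu \ {0}, Octonion.wp ω i v =
      A (Octonion.e i) := by
    have h1 : ∀ v ∈ Octonion.divisionPoints ω lam mu \ {0},
        Octonion.wp ω i v = Octonion.wpSum b v (Octonion.e i) := fun v hv => by
      -- A lattice point in the half-open cell is its own fractional part, hence zero, so nonzero
      -- division points avoid the poles.
      refine Octonion.wp_eq hb i fun h2 => hv.2 ?_
      rw [Octonion.lattice_eq hb] at h2
      rw [hV] at hv
      rw [Set.mem_singleton_iff, ← ZSpan.fract_eq_self.2 hv.1.1, ZSpan.fract_apply,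
        ZSpan.floor_eq_self_of_mem b v h2, sub_self]
    rw [finsum_mem_congr rfl h1, hV, sum_apply]
    have h2 : (Octonion.divisionSet b M \ {0} : Set Octonion) = ↑(S.erase 0) := by
      rw [Finset.coe_erase, Set.Finite.coe_toFinset]
    rw [h2, finsum_mem_coe_finset]
    -- The point `0` may be restored because `wpSum` vanishes there.
    refine Finset.sum_erase _ ?_
    rw [Octonion.wpSum_zero, zero_apply]
  have hA : ∀ h, A (ω h) = -((Octonion.N lam * Octonion.N mu) ^ 3) •
      (mu * ((∑ j, n h j • Octonion.zetaSum b (ω j)) * lam) -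
        (Octonion.N lam * Octonion.N mu) • Octonion.zetaSum b (ω h)) := fun h => by
    have hn' := hn h
    rw [← hb] at hn' ⊢
    rw [sum_apply]
    exact Octonion.sum_wpSum_apply_basis hlam0 hmu0 hMxy hM hn'
  have key := Octonion.sum_Θ_smul ω A i
  rw [hsum, ← inv_smul_smul₀ hdet (A (Octonion.e i)), ← key]
  simp only [Finset.smul_sum, ← Finset.sum_sub_distrib, hA]
  refine Finset.sum_congr rfl fun h _ => ?_
  rw [div_eq_mul_inv]
  module
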